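/- A society $S=(X,(A_v)_{v\in V})$ consists of a set $X$ (the spectrum of candidates), a finite set $V$ of voters, and for each voter $v$ an approval set $A_v\subseteq X$ (different voters may have equal approval sets). Its agreement proportion is $a(S)=\frac{1}{|V|}\max_{x\in X}|\{v\in V: x\in A_v\}|$. It is $(q,p)$-agreeable if among every $p$ voters there are some $q$ whose approval sets have a common point, and $\mathbb{R}^d$-convex if $X=\mathbb{R}^d$ and every $A_v$ is convex. Let $p\ge q\ge d+1$ be integers, where $d\ge 0$. Then there is a constant $t=t(d;p,q)>0$, depending only on $d,p,q$, such that every $\mathbb{R}^d$-convex $(q,p)$-agreeable society $S$ in which at least one approval set is non-empty satisfies $a(S)\ge t$. (For societies with at least $p$ voters, $(q,p)$-agreeability already implies that some approval set is non-empty.) -/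

import Mathlib

/-- A society on the political spectrum `X`: finitely many voters, each with an approval set
contained in `X`. Different voters may have the same approval set. -/
structure Society (X : Type*) where
  /-- the number of voters -/
  numVoters : ℕ
  /-- the approval set of each voter -/
  approval : Fin numVoters → Set X

namespace Society

/-- The degree of a candidate `x`: the number of voters whose approval set contains `x`. -/
noncomputable def degree {X : Type*} (S : Society X) (x : X) : ℕ :=
  {v : Fin S.numVoters | x ∈ S.approval v}.ncard

/-- The agreement number: the maximal degree of a candidate. The degrees are bounded by the number
of voters, so for nonempty `X` this supremum of natural numbers is attained
(`Society.exists_approvalWinner`). -/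
noncomputable def agreementNumber {X : Type*} (S : Society X) : ℕ :=
  ⨆ x : X, S.degree x

/-- The agreement proportion `a(S)`: the agreement number divided by the number of voters. -/
noncomputable def agreementProportion {X : Type*} (S : Society X) : ℝ :=
  (S.agreementNumber : ℝ) / (S.numVoters : ℝ)

/-- A set `T` of voters agrees on a candidate if some candidate lies in all their approval sets. -/
def AgreeOnCandidate {X : Type*} (S : Society X) (T : Finset (Fin S.numVoters)) : Prop :=
  ∃ x : X, ∀ v ∈ T, x ∈ S.approval v

/-- `S` is `(q, p)`-agreeable: among every `p` voters, some `q` of them agree on a candidate. -/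
def IsAgreeable {X : Type*} (S : Society X) (q p : ℕ) : Prop :=
  ∀ P : Finset (Fin S.numVoters), P.card = p →
    ∃ Q : Finset (Fin S.numVoters), Q ⊆ P ∧ Q.card = q ∧ S.AgreeOnCandidate Q

/-- `S` is an `ℝ^d`-convex society: its spectrum is `ℝ^d` and all approval sets are convex. -/
def IsConvex {d : ℕ} (S : Society (EuclideanSpace ℝ (Fin d))) : Prop :=
  ∀ v : Fin S.numVoters, Convex ℝ (S.approval v)

theorem degree_le_numVoters {X : Type*} (S : Society X) (x : X) : S.degree x ≤ S.numVoters := by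
  have h := Set.ncard_le_card {v : Fin S.numVoters | x ∈ S.approval v}
  simpa [degree] using h

theorem exists_approvalWinner {X : Type*} [Nonempty X] (S : Society X) :
    ∃ x : X, S.degree x = S.agreementNumber ∧ ∀ y : X, S.degree y ≤ S.degree x := by
  have hb : BddAbove (Set.range S.degree) :=
    ⟨S.numVoters, by rintro _ ⟨x, rfl⟩; exact S.degree_le_numVoters x⟩
  obtain ⟨x, hx⟩ := Nat.sSup_mem (Set.range_nonempty S.degree) hb
  exact ⟨x, hx, fun y => hx ▸ le_csSup hb ⟨y, rfl⟩⟩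

end Society

/-! Double counting against fractional Helly. Let n be the number of voters and M the agreement
number. If n ≥ p, agreeability with q ≥ d+1 makes at least a fraction 1/C(p,d+1) of the (d+1)-sets
of voters intersecting. Conversely, Helly's theorem shows that the point y of least norm in such an
intersection is already least for some d of the sets. Those d sets determine y by strict convexity,
and the remaining set is one of at most M - d others through y, so at most (M - d)·C(n,d) of the
(d+1)-sets intersect. Comparing the two counts bounds n by a constant times M. -/

open Finset Module in
/-- If `finrank + 1` closed convex sets have a common point, then the point of minimal norm in their
intersection already has minimal norm in the intersection of some `finrank` of them. -/
theorem exists_subset_norm_minimal_of_closed_convex {ι E : Type*} [NormedAddCommGroup E]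
    [NormedSpace ℝ E] [FiniteDimensional ℝ E] {C : ι → Set E} (hconv : ∀ i, Convex ℝ (C i))
    (hclosed : ∀ i, IsClosed (C i)) {T : Finset ι} (hT : #T = finrank ℝ E + 1)
    (hne : ∃ x, ∀ i ∈ T, x ∈ C i) :
    ∃ J ⊆ T, #J = finrank ℝ E ∧ ∃ y, (∀ i ∈ T, y ∈ C i) ∧
      ∀ z, (∀ i ∈ J, z ∈ C i) → ‖y‖ ≤ ‖z‖ := by
  classical
  have hKclosed : IsClosed (⋂ i ∈ T, C i) := isClosed_biInter fun i _ => hclosed i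
  obtain ⟨x, hx⟩ := hne
  obtain ⟨y, hyT, hymin⟩ := hKclosed.exists_infDist_eq_dist ⟨x, by simpa using hx⟩ 0
  have hymem : ∀ i ∈ T, y ∈ C i := by simpa using hyT
  have hyle : ∀ z, (∀ i ∈ T, z ∈ C i) → ‖y‖ ≤ ‖z‖ := fun z hz => by
    have h := Metric.infDist_le_dist_of_mem (x := (0 : E)) (s := ⋂ i ∈ T, C i) (y := z)
      (by simpa using hz)
    rw [hymin] at h
    simpa using h
  by_contra! hcon
  -- The open ball of radius `‖y‖` joins the family as `none`. If no J works, every `finrank + 1` of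
  -- these `finrank + 2` sets meet, so by Helly some point of the whole intersection has norm below
  -- `‖y‖`.
  let F : Option ι → Set E := fun o => o.elim (Metric.ball 0 ‖y‖) C
  have key : (⋂ o ∈ insertNone T, F o).Nonempty := by
    refine Convex.helly_theorem (𝕜 := ℝ) (by simp [hT]) ?_ ?_
    · rintro (_ | i) _
      · exact convex_ball 0 ‖y‖
      · exact hconv i
    · intro I hI hIcard
      by_cases hnone : none ∈ I
      · have hJT : eraseNone I ⊆ T := fun i hi => by
          simpa using hI (mem_eraseNone.1 hi)
        have hJ : #(eraseNone I) = finrank ℝ E := by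
          have h := congrArg Finset.card (insertNone_eraseNone I)
          rw [card_insertNone, insert_eq_of_mem hnone] at h
          omega
        obtain ⟨z, hz, hzy⟩ := hcon _ hJT hJ y hymem
        refine ⟨z, Set.mem_iInter₂.2 ?_⟩
        rintro (_ | i) hi
        · simpa [F] using hzy
        · exact hz i (mem_eraseNone.2 hi)
      · refine ⟨y, Set.mem_iInter₂.2 ?_⟩
        rintro (_ | i) hi
        · exact absurd hi hnone
        · exact hymem i (by simpa using hI hi)
  obtain ⟨z, hz⟩ := key
  rw [Set.mem_iInter₂] at hz
  have hzball : z ∈ Metric.ball (0 : E) ‖y‖ := hz none (by simp)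
  have hzT : ∀ i ∈ T, z ∈ C i := fun i hi => hz (some i) (by simpa using hi)
  rw [mem_ball_zero_iff] at hzball
  exact absurd (hyle z hzT) (not_le.2 hzball)

/-- In a strictly convex space, a convex set has at most one point of minimal norm. -/
theorem Convex.eq_of_norm_minimal {E : Type*} [NormedAddCommGroup E] [NormedSpace ℝ E]
    [StrictConvexSpace ℝ E] {K : Set E} (hK : Convex ℝ K) {y y' : E} (hy : y ∈ K) (hy' : y' ∈ K)
    (hmin : ∀ z ∈ K, ‖y‖ ≤ ‖z‖) (hmin' : ∀ z ∈ K, ‖y'‖ ≤ ‖z‖) : y = y' := by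
  by_contra hne
  have hnorm : ‖y‖ = ‖y'‖ := le_antisymm (hmin _ hy') (hmin' _ hy)
  have hlt := (norm_midpoint_lt_iff hnorm).2 hne
  have hmem : (1 / 2 : ℝ) • (y + y') ∈ K := by
    rw [smul_add]
    exact hK hy hy' (by norm_num) (by norm_num) (by norm_num)
  exact absurd (hmin _ hmem) (not_le.2 hlt)

open Finset Module in
/-- Fractional Helly for closed convex sets: if every point lies in at most `M` of the sets, then
few `(finrank + 1)`-tuples have a common point. -/
theorem card_intersecting_le_of_closed_convex {ι E : Type*} [Fintype ι] [NormedAddCommGroup E]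
    [NormedSpace ℝ E] [StrictConvexSpace ℝ E] [FiniteDimensional ℝ E] {C : ι → Set E}
    (hconv : ∀ i, Convex ℝ (C i)) (hclosed : ∀ i, IsClosed (C i)) {M : ℕ}
    (hM : ∀ x, {i | x ∈ C i}.ncard ≤ M) {G : Finset (Finset ι)}
    (hGcard : ∀ T ∈ G, #T = finrank ℝ E + 1) (hG : ∀ T ∈ G, ∃ x, ∀ i ∈ T, x ∈ C i) :
    #G ≤ (M - finrank ℝ E) * (Fintype.card ι).choose (finrank ℝ E) := by
  classical
  have hex : ∀ T : Finset ι, ∃ J : Finset ι, ∃ y : E, T ∈ G → J ⊆ T ∧ #J = finrank ℝ E ∧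
      (∀ i ∈ T, y ∈ C i) ∧ ∀ z, (∀ i ∈ J, z ∈ C i) → ‖y‖ ≤ ‖z‖ := fun T => by
    by_cases hT : T ∈ G
    · obtain ⟨J, h1, h2, y, h3, h4⟩ := exists_subset_norm_minimal_of_closed_convex hconv hclosed
        (hGcard T hT) (hG T hT)
      exact ⟨J, y, fun _ => ⟨h1, h2, h3, h4⟩⟩
    · exact ⟨∅, 0, fun h => absurd h hT⟩
  choose J y hJy using hex
  have himage : #(G.image J) ≤ (Fintype.card ι).choose (finrank ℝ E) := by
    rw [← card_univ, ← card_powersetCard]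
    refine card_le_card (image_subset_iff.2 fun T hT => ?_)
    exact mem_powersetCard.2 ⟨subset_univ _, (hJy T hT).2.1⟩
  refine (card_le_mul_card_image G (M - finrank ℝ E) fun J₀ hJ₀ => ?_).trans
    (Nat.mul_le_mul_left _ himage)
  obtain ⟨T₀, hT₀, rfl⟩ := mem_image.1 hJ₀
  obtain ⟨hJT₀, hJcard, hyT₀, hymin⟩ := hJy T₀ hT₀
  have hKconv : Convex ℝ {z | ∀ i ∈ J T₀, z ∈ C i} := by
    have h : {z | ∀ i ∈ J T₀, z ∈ C i} = ⋂ i ∈ J T₀, C i := by ext; simp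
    rw [h]
    exact convex_iInter₂ fun i _ => hconv i
  set D : Finset ι := {i | y T₀ ∈ C i} with hD
  have hDM : #D ≤ M := by
    have h := hM (y T₀)
    rwa [show {i | y T₀ ∈ C i} = (D : Set ι) by ext; simp [hD], Set.ncard_coe_finset] at h
  have hJD : J T₀ ⊆ D := fun i hi => by simpa [hD] using hyT₀ i (hJT₀ hi)
  -- Equal J forces equal minimisers, so T is J plus one further set through `y T₀`.
  have hfiber : {T ∈ G | J T = J T₀} ⊆ (D \ J T₀).image fun i => insert i (J T₀) := by
    intro T hT
    obtain ⟨hTG, hJT⟩ := mem_filter.1 hT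
    obtain ⟨hsub, -, hyT, hmin⟩ := hJy T hTG
    rw [hJT] at hsub hmin
    have hyy : y T = y T₀ := hKconv.eq_of_norm_minimal (fun i hi => hyT i (hsub hi))
      (fun i hi => hyT₀ i (hJT₀ hi)) hmin hymin
    have hcard : #(T \ J T₀) = 1 := by
      rw [card_sdiff_of_subset hsub, hGcard T hTG, hJcard]
      omega
    obtain ⟨i, hi⟩ := card_eq_one.1 hcard
    have hiT : i ∈ T \ J T₀ := by simp [hi]
    refine mem_image.2 ⟨i, mem_sdiff.2 ⟨?_, (mem_sdiff.1 hiT).2⟩, ?_⟩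
    · simpa [hD, ← hyy] using hyT i (mem_sdiff.1 hiT).1
    · rw [insert_eq, ← hi, sdiff_union_of_subset hsub]
  calc #{T ∈ G | J T = J T₀} ≤ #(D \ J T₀) := (card_le_card hfiber).trans card_image_le
    _ = #D - finrank ℝ E := by rw [card_sdiff_of_subset hJD, hJcard]
    _ ≤ M - finrank ℝ E := Nat.sub_le_sub_right hDM _

open Finset Module in
/-- Fractional Helly for arbitrary convex sets. -/
theorem card_intersecting_le_of_convex {ι E : Type*} [Fintype ι] [NormedAddCommGroup E]
    [NormedSpace ℝ E] [StrictConvexSpace ℝ E] [FiniteDimensional ℝ E] {A : ι → Set E}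
    (hconv : ∀ i, Convex ℝ (A i)) {M : ℕ} (hM : ∀ x, {i | x ∈ A i}.ncard ≤ M)
    {G : Finset (Finset ι)} (hGcard : ∀ T ∈ G, #T = finrank ℝ E + 1)
    (hG : ∀ T ∈ G, ∃ x, ∀ i ∈ T, x ∈ A i) :
    #G ≤ (M - finrank ℝ E) * (Fintype.card ι).choose (finrank ℝ E) := by
  classical
  choose! x hx using hG
  -- A least-norm point need not exist in a non-closed set. Hulls of finitely many chosen witnesses
  -- are compact, lie inside the `A i`, and keep every tuple of G intersecting.
  let C : ι → Set E := fun i => convexHull ℝ (x '' {T | T ∈ G ∧ i ∈ T})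
  have hCA : ∀ i, C i ⊆ A i := fun i => by
    refine convexHull_min ?_ (hconv i)
    rintro _ ⟨T, ⟨hT, hi⟩, rfl⟩
    exact hx T hT i hi
  refine card_intersecting_le_of_closed_convex (C := C) (fun i => convex_convexHull ℝ _)
    (fun i => ?_) (fun z => ?_) hGcard fun T hT => ⟨x T, fun i hi => ?_⟩
  · exact (((Set.toFinite _).image x).isCompact_convexHull (𝕜 := ℝ)).isClosed
  · exact (Set.ncard_le_ncard (fun i hi => hCA i hi) (Set.toFinite _)).trans (hM z)
  · exact subset_convexHull ℝ _ ⟨T, ⟨hT, hi⟩, rfl⟩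

open Finset in
/-- If every `p`-subset contains a member of a family of `k`-subsets, then the family contains at
least the proportion `1 / p.choose k` of all `k`-subsets. -/
theorem choose_le_choose_mul_card_of_forall_exists_subset {ι : Type*} [Fintype ι] {k p : ℕ}
    (hkp : k ≤ p) (hp : p ≤ Fintype.card ι) {G : Finset (Finset ι)} (hGcard : ∀ T ∈ G, #T = k)
    (hG : ∀ P : Finset ι, #P = p → ∃ T ∈ G, T ⊆ P) :
    (Fintype.card ι).choose k ≤ p.choose k * #G := by
  classical
  set n := Fintype.card ι
  choose! f hfG hfP using hG
  have himage : (powersetCard p univ).image f ⊆ G :=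
    image_subset_iff.2 fun P hP => hfG P (mem_powersetCard.1 hP).2
  -- A fixed k-set lies in only C(n-k, p-k) of the p-sets.
  have hcount : n.choose p ≤ (n - k).choose (p - k) * #G := by
    have h := card_le_mul_card_image (f := f) (powersetCard p (univ : Finset ι))
      ((n - k).choose (p - k)) fun T hT => ?_
    · rw [card_powersetCard, card_univ] at h
      exact h.trans (Nat.mul_le_mul_left _ (card_le_card himage))
    have hTk : #T = k := hGcard T (himage hT)
    have hsub : ∀ P ∈ ({P ∈ powersetCard p univ | f P = T} : Finset (Finset ι)),
        T ⊆ P ∧ #P = p := fun P hP => by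
      obtain ⟨hP, hfPT⟩ := mem_filter.1 hP
      exact ⟨hfPT ▸ hfP P (mem_powersetCard.1 hP).2, (mem_powersetCard.1 hP).2⟩
    have hTc : #(univ \ T) = n - k := by
      rw [card_sdiff_of_subset (subset_univ T), card_univ, hTk]
    rw [← hTc, ← card_powersetCard]
    refine card_le_card_of_injOn (fun P => P \ T) (fun P hP => ?_) fun P hP P' hP' h => ?_
    · obtain ⟨hTP, hPp⟩ := hsub P hP
      refine mem_powersetCard.2 ⟨sdiff_subset_sdiff (subset_univ P) subset_rfl, ?_⟩
      rw [card_sdiff_of_subset hTP, hPp, hTk]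
    · rw [← sdiff_union_of_subset (hsub P hP).1, ← sdiff_union_of_subset (hsub P' hP').1]
      exact congrArg (· ∪ T) h
  have hpos : 0 < (n - k).choose (p - k) := Nat.choose_pos (by omega)
  refine Nat.le_of_mul_le_mul_right ?_ hpos
  calc n.choose k * (n - k).choose (p - k) = n.choose p * p.choose k :=
        (Nat.choose_mul hkp).symm
    _ ≤ (n - k).choose (p - k) * #G * p.choose k := Nat.mul_le_mul_right _ hcount
    _ = p.choose k * #G * (n - k).choose (p - k) := by ring

open Finset in
/-- The number of voters of a convex agreeable society is at most a constant times its agreement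
number. -/
theorem Society.IsConvex.numVoters_le {d p q : ℕ} (hdq : d + 1 ≤ q) (hqp : q ≤ p)
    {S : Society (EuclideanSpace ℝ (Fin d))} (hconv : S.IsConvex) (hagree : S.IsAgreeable q p)
    (hp : p ≤ S.numVoters) :
    S.numVoters ≤ (d + 1) * p.choose (d + 1) * S.agreementNumber := by
  classical
  obtain ⟨w, hw, hmax⟩ := S.exists_approvalWinner
  rw [← hw]
  set n := S.numVoters
  set M := S.degree w
  let G : Finset (Finset (Fin n)) := {T ∈ powersetCard (d + 1) univ | S.AgreeOnCandidate T}
  have hGcard : ∀ T ∈ G, #T = d + 1 := fun T hT =>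
    (mem_powersetCard.1 (mem_filter.1 hT).1).2
  have hlower : n.choose (d + 1) ≤ p.choose (d + 1) * #G := by
    have h := choose_le_choose_mul_card_of_forall_exists_subset (hdq.trans hqp)
      (by simpa using hp) hGcard fun P hP => ?_
    · simpa using h
    obtain ⟨Q, hQP, hQq, x, hx⟩ := hagree P hP
    obtain ⟨T, hTQ, hT⟩ := exists_subset_card_eq (hdq.trans hQq.ge)
    exact ⟨T, mem_filter.2 ⟨mem_powersetCard.2 ⟨subset_univ _, hT⟩, x, fun v hv => hx v (hTQ hv)⟩,
      hTQ.trans hQP⟩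
  have hupper : #G ≤ (M - d) * n.choose d := by
    simpa using card_intersecting_le_of_convex hconv (M := M) hmax (G := G)
      (by simpa using hGcard) fun T hT => (mem_filter.1 hT).2
  have hsub : n - d ≤ (d + 1) * p.choose (d + 1) * (M - d) := by
    have hpos : 0 < n.choose d := Nat.choose_pos (by omega)
    refine Nat.le_of_mul_le_mul_left ?_ hpos
    calc n.choose d * (n - d) = n.choose (d + 1) * (d + 1) := (Nat.choose_succ_right_eq n d).symm
      _ ≤ p.choose (d + 1) * ((M - d) * n.choose d) * (d + 1) :=
        Nat.mul_le_mul_right _ (hlower.trans (Nat.mul_le_mul_left _ hupper))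
      _ = n.choose d * ((d + 1) * p.choose (d + 1) * (M - d)) := by ring
  have hc : 1 ≤ (d + 1) * p.choose (d + 1) :=
    Nat.mul_pos d.succ_pos (Nat.choose_pos (hdq.trans hqp))
  -- Otherwise the truncated M - d is 0, forcing n ≤ d, although n ≥ p ≥ d+1.
  have hdM : d ≤ M := by
    by_contra! h
    rw [Nat.sub_eq_zero_of_le h.le, mul_zero] at hsub
    omega
  calc n = (n - d) + d := by omega
    _ ≤ (d + 1) * p.choose (d + 1) * (M - d) + (d + 1) * p.choose (d + 1) * d :=
      Nat.add_le_add hsub (Nat.le_mul_of_pos_left d hc)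
    _ = (d + 1) * p.choose (d + 1) * M := by rw [← mul_add, Nat.sub_add_cancel hdM]

/-- If some approval set is non-empty, the agreement number is positive. -/
theorem Society.agreementNumber_pos {X : Type*} {S : Society X}
    (h : ∃ v, (S.approval v).Nonempty) : 0 < S.agreementNumber := by
  obtain ⟨v, x, hx⟩ := h
  have : Nonempty X := ⟨x⟩
  obtain ⟨w, hw, hmax⟩ := S.exists_approvalWinner
  rw [← hw]
  exact ((Set.ncard_pos (Set.toFinite _)).2 ⟨v, hx⟩).trans_le (hmax x)

theorem mainTheorem2 (d p q : ℕ) (hdq : d + 1 ≤ q) (hqp : q ≤ p) :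
    ∃ t : ℝ, 0 < t ∧
      ∀ S : Society (EuclideanSpace ℝ (Fin d)), S.IsConvex → S.IsAgreeable q p →
        (∃ v : Fin S.numVoters, (S.approval v).Nonempty) →
          t ≤ S.agreementProportion := by
  have hchoose : 0 < p.choose (d + 1) := Nat.choose_pos (hdq.trans hqp)
  have hc : 0 < (d + 1) * p.choose (d + 1) + p := by positivity
  -- The summand p covers n < p, where agreeability is vacuous and only M ≥ 1 is available.
  refine ⟨1 / (((d + 1) * p.choose (d + 1) + p : ℕ) : ℝ), by positivity,
    fun S hconv hagree hne => ?_⟩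
  have hM := Society.agreementNumber_pos hne
  have hn : 0 < S.numVoters := hne.choose.pos
  have hle : S.numVoters ≤ S.agreementNumber * ((d + 1) * p.choose (d + 1) + p) := by
    rcases le_or_gt p S.numVoters with hp | hp
    · have := hconv.numVoters_le hdq hqp hagree hp
      nlinarith
    · nlinarith
  rw [Society.agreementProportion, div_le_div_iff₀ (by exact_mod_cast hc) (by exact_mod_cast hn),
    one_mul]
  exact_mod_cast hle
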